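/- Let $(x,y)$ have law $F$ on $\mathbb R^d\times\mathbb R$, $d\ge 1$, and let $n=Kn_s$ i.i.d. observations from $F$ be given, with $K\ge 2$ and $n_s\ge 1$. Assume that $y=x^T\beta+u$ with $\mathbb E[ux]=0$, and that no regressor $x_j$ with $\beta_j\ne 0$ is almost surely a linear combination of the other regressors. The sample is partitioned, independently of the data, into $K$ folds of size $n_s$. For $q=1,\dots,K$ the $q$-th test set $(X_s^q,Y_s^q)$ consists of the observations in fold $q$, and the $q$-th training set $(X_t^q,Y_t^q)$ of the remaining $n_t=(K-1)n_s$ observations. Write $\mathcal R_m(b\mid X,Y)=\frac1m\|Y-Xb\|_2^2$ for data with $m$ rows, and $\mathcal R(b)=\mathbb E_F[(y-x^Tb)^2]$. Let $\mathcal L\subseteq[0,\infty)$ be a set of penalties with $0\in\mathcal L$. For each $k$ and each $\lambda\in\mathcal L$ let $b_\lambda^k$ be a (measurable) minimizer of $\mathcal R_{n_t}(b\mid X_t^k,Y_t^k)+\lambda\|b\|_1$ over $b\in\mathbb R^d$, and let $b^k_{train}=b^k_0$ be the extremum estimator without penalty. Let $(k^*,q^*)$ be a (measurable) maximizer of $\mathcal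 R_{n_s}(b^k_{train}\mid X_s^q,Y_s^q)$ over all $k,q\in\{1,\dots,K\}$, and put $\bar b_{train}=b_{train}^{k^*}$ (the worst-case extremum estimator). Let $b_{Lasso}$ be the cross-validated Lasso estimator: a minimizer of $\frac1K\sum_{q=1}^K\mathcal R_{n_s}(b\mid X_s^q,Y_s^q)$ among the Lasso estimators $b=b_\lambda^{k^*}$, $\lambda\in\mathcal L$, computed on the same training set as $\bar b_{train}$. Let $r>1$, and let $\tau>0$ be such that $\mathbb E_F[|y-x^Tb|^{2r}]<\infty$ and $(\mathbb E_F[|y-x^Tb|^{2r}])^{1/r}\le\tau\,\mathcal R(b)$ for all $b\in\mathbb R^d$. Let $\varpi_1,\dots,\varpi_K\in(0,1)$ and $\bar\varpi=\varpi_{k^*}$. Let $$\bar\epsilon=\frac1{n_t}\Big(d\ln\frac{n_t}{d}+d+\ln n_t\Big),\qquad \bar\varsigma=\frac{2^{1/r}\,\tau\,\mathcal R(\bar b_{train})}{(1-\bar\varpi)^{1/r}\,n_s^{1-1/r}},$$ and suppose that $0\le\bar\epsilon<1$. Put $\overline{e_t}=Y_t^{q^*}-X_t^{q^*}\bar b_{train}$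 and $\overline{e_s^q}=Y_s^q-X_s^q\bar b_{train}$. Then, with probability at least $\bar\varpi(1-1/n_t)$, $$\frac1K\sum_{q=1}^K\frac1{n_s}\|X_s^q\bar b_{train}-X_s^qb_{Lasso}\|_2^2\le\left|\frac1{n_t}\frac{\|\overline{e_t}\|_2^2}{1-\sqrt{\bar\epsilon}}-\frac1K\sum_{q=1}^K\frac1{n_s}\|\overline{e_s^q}\|_2^2\right|+\frac1K\sum_{q=1}^K\frac4{n_s}\big\|(\overline{e_s^q})^TX_s^q\big\|_\infty\|\bar b_{train}\|_1+\bar\varsigma .$$ Since $\bar\varpi$ depends on the random index $k^*$, the probability statement means: the probability of this inequality is at least $\mathbb E[\bar\varpi](1-1/n_t)$, and, for each $k$, the probability that $k^*=k$ and the inequality holds is at least $\varpi_k(1-1/n_t)\,\mathbb P(k^*=k)$. -/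

import Mathlib

open MeasureTheory ProbabilityTheory

noncomputable section

namespace CVLasso

/-- One observation `(x, y)`: a vector of `d` regressors and a scalar response. -/
abbrev Obs (d : ℕ) : Type := (Fin d → ℝ) × ℝ

/-- The residual `y - xᵀ b`. -/
def resid {d : ℕ} (z : Obs d) (b : Fin d → ℝ) : ℝ := z.2 - z.1 ⬝ᵥ b

/-- The quadratic loss `(y - xᵀ b) ^ 2`. -/
def loss {d : ℕ} (z : Obs d) (b : Fin d → ℝ) : ℝ := resid z b ^ 2

/-- The `ℓ¹` norm of a coefficient vector. -/
def l1norm {d : ℕ} (b : Fin d → ℝ) : ℝ := ∑ j, |b j|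

/-- The empirical risk of `b` on the observations with index in `I`. -/
def empRisk {ι : Type*} {d : ℕ} (D : ι → Obs d) (I : Finset ι) (b : Fin d → ℝ) : ℝ :=
  (1 / (I.card : ℝ)) * ∑ i ∈ I, loss (D i) b

/-- The population risk `∫ (y - xᵀ b) ^ 2 dF(x, y)`. -/
def popRisk {d : ℕ} (F : Measure (Obs d)) (b : Fin d → ℝ) : ℝ := ∫ z, loss z b ∂F

/-- The `q`-th test set: the observations in fold `q`. -/
def testSet {n K : ℕ} (f : Fin n → Fin K) (q : Fin K) : Finset (Fin n) :=
  Finset.univ.filter fun i => f i = q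

/-- The `q`-th training set: the observations in the remaining folds. -/
def trainSet {n K : ℕ} (f : Fin n → Fin K) (q : Fin K) : Finset (Fin n) :=
  Finset.univ.filter fun i => f i ≠ q

/-- The average over the `K` test sets of the empirical risk (the generalization error) of `b`. -/
def cvError {n K d : ℕ} (D : Fin n → Obs d) (f : Fin n → Fin K) (b : Fin d → ℝ) : ℝ :=
  (1 / (K : ℝ)) * ∑ q, empRisk D (testSet f q) b

/-- `b` is a Lasso estimator with penalty `lam`, computed on the observations in `I`.  For
`lam = 0` this says that `b` is an extremum estimator: it minimizes the empirical risk on `I`. -/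
def IsLasso {ι : Type*} {d : ℕ} (D : ι → Obs d) (I : Finset ι) (lam : ℝ) (b : Fin d → ℝ) : Prop :=
  ∀ c : Fin d → ℝ, empRisk D I b + lam * l1norm b ≤ empRisk D I c + lam * l1norm c

/-- The vector `eᵀ X`, where `X` has the rows `xᵢ` and `e` the entries `yᵢ - xᵢᵀ b`, for `i ∈ I`. -/
def residDesign {ι : Type*} {d : ℕ} (D : ι → Obs d) (I : Finset ι) (b : Fin d → ℝ) : Fin d → ℝ :=
  fun j => ∑ i ∈ I, resid (D i) b * (D i).1 j

/-- `‖X b - X c‖₂ ^ 2`, where `X` has the rows `xᵢ`, for `i ∈ I`. -/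
def predGapSq {ι : Type*} {d : ℕ} (D : ι → Obs d) (I : Finset ι) (b c : Fin d → ℝ) : ℝ :=
  ∑ i ∈ I, ((D i).1 ⬝ᵥ b - (D i).1 ⬝ᵥ c) ^ 2

/-- The quantity `ε = (1 / n) (h ln (n / h) + h - ln η)` of the Vapnik–Chervonenkis inequality. -/
def vcEps (h n : ℕ) (η : ℝ) : ℝ :=
  (1 / (n : ℝ)) * (h * Real.log ((n : ℝ) / h) + h - Real.log η)

/-- The Bahr–Esseen term
`ς = 2 ^ (1/r) τ 𝔼[Loss] / ((1 - ϖ) ^ (1/r) m ^ (1 - 1/r))`, for a test set of size `m`, where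
`risk` stands for `𝔼[Loss]`. -/
def bahrEsseen (r τ ϖ : ℝ) (m : ℕ) (risk : ℝ) : ℝ :=
  (2 : ℝ) ^ (1 / r) * τ * risk / ((1 - ϖ) ^ (1 / r) * (m : ℝ) ^ (1 - 1 / r))

/-- `τ` bounds `(𝔼[Loss ^ r]) ^ (1/r) / 𝔼[Loss]` over all linear models `b`, the moments of order
`r` of the loss being finite. -/
def IsTailBound {d : ℕ} (F : Measure (Obs d)) (r τ : ℝ) : Prop :=
  0 < τ ∧ ∀ b : Fin d → ℝ, Integrable (fun z => loss z b ^ r) F ∧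
    (∫ z, loss z b ^ r ∂F) ^ (1 / r) ≤ τ * popRisk F b

/-- The population is a linear model `y = xᵀ β + u` with `u = y - xᵀ β` such that `𝔼[u x] = 0`,
and no regressor with a non-zero coefficient is (almost surely) a linear combination of the other
regressors. -/
structure IsTrueDGP {d : ℕ} (F : Measure (Obs d)) (β : Fin d → ℝ) : Prop where
  integrable : ∀ j, Integrable (fun z : Obs d => resid z β * z.1 j) F
  exogenous : ∀ j, ∫ z, resid z β * z.1 j ∂F = 0
  unique : ∀ j, β j ≠ 0 →
    ¬ ∃ c : Fin d → ℝ, c j = 0 ∧ ∀ᵐ z ∂F, z.1 j = z.1 ⬝ᵥ c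

end CVLasso

end

/-! The inequality holds at every sample point, so its event has probability one, and the claim
reduces to `ϖ k * (1 - 1 / nt) ≤ 1`. Write `b` for the extremum estimator, `c` for the
cross-validated Lasso and `e` for the residuals of `b`. Expanding squares gives `‖Xb - Xc‖² = loss c
- loss b - 2 eᵀX(b - c)` (`predGapSq_eq`). Averaged over the folds, the loss difference is at most
zero, because `λ = 0` competes in the cross-validation. Hölder bounds the cross term by `2 ‖eᵀX‖∞ ‖b
- c‖₁`, and `‖c‖₁ ≤ ‖b‖₁` turns this into `4 ‖eᵀX‖∞ ‖b‖₁`. The absolute value and the Bahr–Esseen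
term are nonnegative and only enlarge the bound. -/

open Finset in
/-- The square `‖X b - X c‖₂ ^ 2` expressed through the losses of `b` and `c` and the residuals
of `b`. -/
theorem CVLasso.predGapSq_eq {ι : Type*} {d : ℕ} (D : ι → CVLasso.Obs d) (I : Finset ι)
    (b c : Fin d → ℝ) :
    CVLasso.predGapSq D I b c = ∑ i ∈ I, CVLasso.loss (D i) c - ∑ i ∈ I, CVLasso.loss (D i) b
      - 2 * (CVLasso.residDesign D I b ⬝ᵥ (b - c)) := by
  have h : CVLasso.residDesign D I b ⬝ᵥ (b - c)
      = ∑ i ∈ I, CVLasso.resid (D i) b * ((D i).1 ⬝ᵥ b - (D i).1 ⬝ᵥ c) := by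
    simp only [← dotProduct_sub]
    simp only [dotProduct, CVLasso.residDesign, sum_mul, mul_sum]
    rw [sum_comm]
    simp only [mul_assoc]
  rw [h, mul_sum, ← sum_sub_distrib, ← sum_sub_distrib]
  refine sum_congr rfl fun i _ => ?_
  simp only [CVLasso.loss, CVLasso.resid]
  ring

/-- Hölder's inequality for the sup norm and the `ℓ¹` norm. -/
theorem CVLasso.abs_dotProduct_le {d : ℕ} (v b : Fin d → ℝ) :
    |v ⬝ᵥ b| ≤ ‖v‖ * CVLasso.l1norm b := by
  rw [CVLasso.l1norm, Finset.mul_sum]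
  refine (Finset.abs_sum_le_sum_abs _ _).trans (Finset.sum_le_sum fun j _ => ?_)
  rw [abs_mul]
  gcongr
  exact norm_le_pi_norm v j

theorem CVLasso.l1norm_sub_le {d : ℕ} (b c : Fin d → ℝ) :
    CVLasso.l1norm (b - c) ≤ CVLasso.l1norm b + CVLasso.l1norm c := by
  simp only [CVLasso.l1norm, ← Finset.sum_add_distrib]
  exact Finset.sum_le_sum fun j _ => abs_sub (b j) (c j)

/-- A positive penalty shrinks the `ℓ¹` norm of the extremum estimator. -/
theorem CVLasso.IsLasso.l1norm_le {ι : Type*} {d : ℕ} {D : ι → CVLasso.Obs d} {I : Finset ι}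
    {lam : ℝ} {b c : Fin d → ℝ} (hlam : 0 < lam) (hc : CVLasso.IsLasso D I lam c)
    (hb : CVLasso.IsLasso D I 0 b) : CVLasso.l1norm c ≤ CVLasso.l1norm b := by
  have h₁ := hc b
  have h₂ := hb c
  simp only [zero_mul, add_zero] at h₂
  -- Adding the two optimality inequalities cancels both empirical risks; dividing by the penalty
  -- requires it to be strictly positive.
  exact le_of_mul_le_mul_left (by linarith) hlam

/-- The basic inequality: an estimator whose generalization error and `ℓ¹` norm do not exceed those
of `b` has predictions on the test sets which are close to those of `b`. -/
theorem CVLasso.avg_predGapSq_le {n K d m : ℕ} (D : Fin n → CVLasso.Obs d) (f : Fin n → Fin K)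
    (hcard : ∀ q, (CVLasso.testSet f q).card = m) (b c : Fin d → ℝ)
    (hcv : CVLasso.cvError D f c ≤ CVLasso.cvError D f b)
    (hl1 : CVLasso.l1norm c ≤ CVLasso.l1norm b) :
    (1 / (K : ℝ)) * ∑ q, (1 / (m : ℝ)) * CVLasso.predGapSq D (CVLasso.testSet f q) b c ≤
      (1 / (K : ℝ)) * ∑ q, (4 / (m : ℝ)) *
        ‖CVLasso.residDesign D (CVLasso.testSet f q) b‖ * CVLasso.l1norm b := by
  have hq : ∀ q, (1 / (m : ℝ)) * CVLasso.predGapSq D (CVLasso.testSet f q) b c ≤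
      (CVLasso.empRisk D (CVLasso.testSet f q) c - CVLasso.empRisk D (CVLasso.testSet f q) b) +
        (4 / (m : ℝ)) * ‖CVLasso.residDesign D (CVLasso.testSet f q) b‖ *
          CVLasso.l1norm b := by
    intro q
    -- The cross term enters with a minus sign, so only the lower bound on it matters.
    have h₁ := (abs_le.mp (CVLasso.abs_dotProduct_le
      (CVLasso.residDesign D (CVLasso.testSet f q) b) (b - c))).1
    have h₂ : ‖CVLasso.residDesign D (CVLasso.testSet f q) b‖ * CVLasso.l1norm (b - c) ≤
        ‖CVLasso.residDesign D (CVLasso.testSet f q) b‖ * (2 * CVLasso.l1norm b) := by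
      gcongr
      -- The triangle inequality gives a factor 2; with the 2 of the cross term it makes the
      -- constant 4.
      linarith [CVLasso.l1norm_sub_le b c]
    rw [CVLasso.predGapSq_eq, CVLasso.empRisk, CVLasso.empRisk, hcard q]
    have h₃ := mul_le_mul_of_nonneg_left (h₂.trans' (neg_le.mp h₁))
      (show (0 : ℝ) ≤ 2 * (1 / (m : ℝ)) by positivity)
    linear_combination h₃
  have hsum := Finset.sum_le_sum fun q (_ : q ∈ Finset.univ) => hq q
  rw [Finset.sum_add_distrib, Finset.sum_sub_distrib] at hsum
  have h := mul_le_mul_of_nonneg_left hsum (show (0 : ℝ) ≤ 1 / (K : ℝ) by positivity)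
  -- The risk of `c` may exceed that of `b` on a single fold; only the average over folds is
  -- controlled.
  simp only [CVLasso.cvError] at hcv
  linarith

theorem CVLasso.bahrEsseen_nonneg {r τ ϖ risk : ℝ} (m : ℕ) (hτ : 0 ≤ τ) (hϖ : ϖ ≤ 1)
    (hrisk : 0 ≤ risk) : 0 ≤ CVLasso.bahrEsseen r τ ϖ m risk := by
  have := sub_nonneg.mpr hϖ
  unfold CVLasso.bahrEsseen
  positivity

theorem CVLasso.popRisk_nonneg {d : ℕ} (F : Measure (CVLasso.Obs d)) (b : Fin d → ℝ) :
    0 ≤ CVLasso.popRisk F b :=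
  integral_nonneg fun _ => sq_nonneg _

theorem corollary2
    {Ω : Type*} [MeasurableSpace Ω] (P : Measure Ω) [IsProbabilityMeasure P]
    -- number of regressors, number of folds, size of a test set, size of a training set
    (d K ns nt : ℕ) (hd : 1 ≤ d) (hK : 2 ≤ K) (hns : 1 ≤ ns) (hnt : nt = (K - 1) * ns)
    -- the population, a linear model with true coefficients `β`
    (F : Measure (CVLasso.Obs d)) [IsProbabilityMeasure F]
    (β : Fin d → ℝ) (hβ : CVLasso.IsTrueDGP F β)
    -- the i.i.d. sample from the population
    (Z : Fin (K * ns) → Ω → CVLasso.Obs d) (hZ : ∀ i, Measurable (Z i))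
    (hZind : iIndepFun Z P) (hZlaw : ∀ i, P.map (Z i) = F)
    -- the random partition of the sample into `K` folds of size `ns`
    (fold : Ω → Fin (K * ns) → Fin K) (hfold : Measurable fold)
    (hfoldind : IndepFun fold (fun ω i => Z i ω) P)
    (hfoldcard : ∀ ω q, (CVLasso.testSet (fold ω) q).card = ns)
    -- the Lasso estimators `b_λ` on the `k`-th training set, for `λ` in a set of penalties which
    -- contains `0`; the extremum estimator on the `k`-th training set is `bLam k 0`
    (L : Set ℝ) (hL : ∀ lam ∈ L, 0 ≤ lam) (hL0 : (0 : ℝ) ∈ L)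
    (bLam : Fin K → ℝ → Ω → Fin d → ℝ) (hbLam : ∀ k, ∀ lam ∈ L, Measurable (bLam k lam))
    (hLasso : ∀ k, ∀ lam ∈ L, ∀ ω,
      CVLasso.IsLasso (fun i => Z i ω) (CVLasso.trainSet (fold ω) k) lam (bLam k lam ω))
    -- the worst case: the pair `(k, q)` with the largest error of `bLam k 0` on the test set `q`
    (kstar qstar : Ω → Fin K) (hkstar : Measurable kstar) (hqstar : Measurable qstar)
    (hstar : ∀ ω k q,
      CVLasso.empRisk (fun i => Z i ω) (CVLasso.testSet (fold ω) q) (bLam k 0 ω) ≤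
        CVLasso.empRisk (fun i => Z i ω) (CVLasso.testSet (fold ω) (qstar ω))
          (bLam (kstar ω) 0 ω))
    (bBar : Ω → Fin d → ℝ) (hbBar : ∀ ω, bBar ω = bLam (kstar ω) 0 ω)
    -- the cross-validated Lasso: the `b_λ` with the least error averaged over the `K` test sets
    (bLasso : Ω → Fin d → ℝ) (hbLasso : Measurable bLasso)
    (hbLasso_mem : ∀ ω, ∃ lam ∈ L, bLasso ω = bLam (kstar ω) lam ω)
    (hbLasso_min : ∀ ω, ∀ lam ∈ L,
      CVLasso.cvError (fun i => Z i ω) (fold ω) (bLasso ω) ≤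
        CVLasso.cvError (fun i => Z i ω) (fold ω) (bLam (kstar ω) lam ω))
    -- the constants of the bound
    (r τ : ℝ) (hr : 1 < r) (hτ : CVLasso.IsTailBound F r τ)
    (ϖ : Fin K → ℝ) (hϖ : ∀ k, ϖ k ∈ Set.Ioo (0 : ℝ) 1)
    (ε : ℝ) (hε : ε = CVLasso.vcEps d nt (1 / (nt : ℝ))) (hε0 : 0 ≤ ε) (hε1 : ε < 1)
    -- the event that the bound holds
    (E : Set Ω)
    (hE : E = {ω |
      (1 / (K : ℝ)) * ∑ q, (1 / (ns : ℝ)) *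
          CVLasso.predGapSq (fun i => Z i ω) (CVLasso.testSet (fold ω) q) (bBar ω) (bLasso ω) ≤
        |CVLasso.empRisk (fun i => Z i ω) (CVLasso.trainSet (fold ω) (qstar ω)) (bBar ω) /
              (1 - Real.sqrt ε)
            - (1 / (K : ℝ)) * ∑ q,
                CVLasso.empRisk (fun i => Z i ω) (CVLasso.testSet (fold ω) q) (bBar ω)|
          + (1 / (K : ℝ)) * ∑ q, (4 / (ns : ℝ)) *
              ‖CVLasso.residDesign (fun i => Z i ω) (CVLasso.testSet (fold ω) q) (bBar ω)‖ *
                CVLasso.l1norm (bBar ω)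
          + CVLasso.bahrEsseen r τ (ϖ (kstar ω)) ns (CVLasso.popRisk F (bBar ω))}) :
    (∫ ω, ϖ (kstar ω) ∂P) * (1 - 1 / (nt : ℝ)) ≤ P.real E ∧
    ∀ k, ϖ k * (1 - 1 / (nt : ℝ)) * P.real {ω | kstar ω = k} ≤
      P.real ({ω | kstar ω = k} ∩ E) := by
  have hE_univ : E = Set.univ := by
    rw [hE, Set.eq_univ_iff_forall]
    intro ω
    obtain ⟨lam, hlam, hlam_eq⟩ := hbLasso_mem ω
    have hl1 : CVLasso.l1norm (bLasso ω) ≤ CVLasso.l1norm (bBar ω) := by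
      rw [hlam_eq, hbBar ω]
      -- At `λ = 0` the shrinkage argument fails, since unpenalized minimizers may have different
      -- norms, but there both estimators are the same `bLam (kstar ω) 0 ω`.
      rcases (hL lam hlam).eq_or_lt with rfl | hpos
      · exact le_rfl
      · exact (hLasso _ lam hlam ω).l1norm_le hpos (hLasso _ 0 hL0 ω)
    have hcv := hbLasso_min ω 0 hL0
    rw [← hbBar ω] at hcv
    have hgap := CVLasso.avg_predGapSq_le (fun i => Z i ω) (fold ω) (hfoldcard ω) _ _ hcv hl1
    have hς := CVLasso.bahrEsseen_nonneg (r := r) ns hτ.1.le (hϖ (kstar ω)).2.le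
      (CVLasso.popRisk_nonneg F (bBar ω))
    exact (hgap.trans (le_add_of_nonneg_left (abs_nonneg _))).trans (le_add_of_nonneg_right hς)
  have hnt1 : (1 : ℝ) ≤ nt := by
    rw [hnt]
    exact_mod_cast Nat.mul_pos (by omega : 0 < K - 1) hns
  have hη0 : 0 ≤ 1 - 1 / (nt : ℝ) := sub_nonneg.mpr ((div_le_one (by linarith)).mpr hnt1)
  have hη1 : 1 - 1 / (nt : ℝ) ≤ 1 := sub_le_self _ (by positivity)
  subst hE_univ
  refine ⟨?_, fun k => ?_⟩
  · rw [probReal_univ]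
    refine mul_le_one₀ ?_ hη0 hη1
    -- Bounding the norm of the integral by a constant avoids proving integrability of `ϖ (kstar
    -- ω)`.
    have h := norm_integral_le_of_norm_le_const (μ := P) (f := fun ω => ϖ (kstar ω)) (C := 1)
      (.of_forall fun ω => by
        rw [Real.norm_of_nonneg (hϖ _).1.le]
        exact (hϖ _).2.le)
    rw [probReal_univ, mul_one] at h
    exact (Real.le_norm_self _).trans h
  · rw [Set.inter_univ]
    exact mul_le_of_le_one_left measureReal_nonneg (mul_le_one₀ (hϖ k).2.le hη0 hη1)
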